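/- Conventions. A solution $(X,r)$ is a non-empty set $X$ of arbitrary cardinality with a bijective map $r\colon X^2\to X^2$, written $r(x,y)=(\lambda_x(y),\rho_y(x))$, such that all maps $\lambda_x,\rho_y\colon X\to X$ are bijective and $(r\times\mathrm{id})(\mathrm{id}\times r)(r\times\mathrm{id})=(\mathrm{id}\times r)(r\times\mathrm{id})(\mathrm{id}\times r)$ on $X^3$. Its retract $\mathrm{Ret}(X,r)$ is the solution induced by $r$ on $X/{\sim}$, where $x\sim y$ if and only if $\lambda_x=\lambda_y$ and $\rho_x=\rho_y$; put $(X_0,r_0)=(X,r)$ and $(X_n,r_n)=\mathrm{Ret}(X_{n-1},r_{n-1})$ for $n\ge 1$. The solution $(X,r)$ is of multipermutation level $m\ge 0$ if $|X_m|=1$ and, in case $m>0$, $|X_{m-1}|>1$. It is of finite multipermutation level if it is of multipermutation level $m$ for some integer $m\ge 0$. Let $M=M(X,r)$ be the monoid, and $G=G(X,r)$ the group, generated by $X$ with the relations $x\circ y=\lambda_x(y)\circ\rho_y(x)$ for all $x,y\in X$. For $H\in\{M,G\}$ with its canonical map $\iota\colon X\to H$, the associated solution is $(H,r_H)$ with $r_H(a,b)=(\lambda_a(b),\rho_b(a))$,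 where $\lambda_a,\rho_a\colon H\to H$ $(a\in H)$ are the unique families of maps such that, for all $x,y\in X$ and $a,b,c\in H$: $\lambda_{\iota(x)}(\iota(y))=\iota(\lambda_x(y))$ and $\rho_{\iota(y)}(\iota(x))=\iota(\rho_y(x))$; $\lambda_1=\rho_1=\mathrm{id}_H$, $\lambda_{a\circ b}=\lambda_a\lambda_b$ and $\rho_{a\circ b}=\rho_b\rho_a$; $\lambda_a(1)=\rho_a(1)=1$, $\lambda_a(b\circ c)=\lambda_a(b)\circ\lambda_{\rho_b(a)}(c)$ and $\rho_a(b\circ c)=\rho_{\lambda_c(a)}(b)\circ\rho_a(c)$; and $a\circ b=\lambda_a(b)\circ\rho_b(a)$. Theorem. Let $(X,r)$ be a solution. The following properties are equivalent: (1) the solution $(X,r)$ is of finite multipermutation level; (2) the associated solution $(M,r_M)$ is of finite multipermutation level; (3) the associated solution $(G,r_G)$ is of finite multipermutation level. Moreover, if $(X,r)$ is of multipermutation level $m$, then $(M,r_M)$ and $(G,r_G)$ are of finite multipermutation levels, each at most $m+1$. -/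

import Mathlib

open Function

universe u

namespace YangBaxter

/-- `r × id` on `X × X × X`. -/
def onLeft {X : Type u} (r : X × X → X × X) : X × X × X → X × X × X :=
  fun t => ((r (t.1, t.2.1)).1, (r (t.1, t.2.1)).2, t.2.2)

/-- `id × r` on `X × X × X`. -/
def onRight {X : Type u} (r : X × X → X × X) : X × X × X → X × X × X :=
  fun t => (t.1, r t.2)

/-- A solution of the Yang--Baxter equation on the set `X`: a bijective non-degenerate set-theoretic
solution `r (x, y) = (lam x y, rho y x)` on a non-empty set. -/
structure Solution (X : Type u) where
  nonempty : Nonempty X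
  r : X × X → X × X
  bijective : Bijective r
  lam_bijective : ∀ x, Bijective (fun y => (r (x, y)).1)
  rho_bijective : ∀ y, Bijective (fun x => (r (x, y)).2)
  braid : onLeft r ∘ onRight r ∘ onLeft r = onRight r ∘ onLeft r ∘ onRight r

namespace Solution

variable {X : Type u} (S : Solution X)

/-- `lam x y` is `λ_x(y)`. -/
def lam (x y : X) : X := (S.r (x, y)).1

/-- `rho y x` is `ρ_y(x)`. -/
def rho (y x : X) : X := (S.r (x, y)).2

theorem r_eq (x y : X) : S.r (x, y) = (S.lam x y, S.rho y x) := rfl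

theorem lam_bij (x : X) : Bijective (S.lam x) := S.lam_bijective x

theorem rho_bij (y : X) : Bijective (S.rho y) := S.rho_bijective y

theorem braid_apply (x y z : X) :
    S.lam (S.lam x y) (S.lam (S.rho y x) z) = S.lam x (S.lam y z) ∧
    S.rho (S.lam (S.rho y x) z) (S.lam x y) = S.lam (S.rho (S.lam y z) x) (S.rho z y) ∧
    S.rho z (S.rho y x) = S.rho (S.rho z y) (S.rho (S.lam y z) x) := by
  have h := congrFun S.braid (x, y, z)
  simp only [comp_apply, onLeft, onRight, r_eq, Prod.mk.injEq] at h
  exact h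

theorem lam_lam (x y z : X) :
    S.lam (S.lam x y) (S.lam (S.rho y x) z) = S.lam x (S.lam y z) := (S.braid_apply x y z).1

theorem mid (x y z : X) :
    S.rho (S.lam (S.rho y x) z) (S.lam x y) = S.lam (S.rho (S.lam y z) x) (S.rho z y) :=
  (S.braid_apply x y z).2.1

theorem rho_rho (x y z : X) :
    S.rho z (S.rho y x) = S.rho (S.rho z y) (S.rho (S.lam y z) x) := (S.braid_apply x y z).2.2

theorem pair_inj {x y x' y' : X} (h1 : S.lam x y = S.lam x' y') (h2 : S.rho y x = S.rho y' x') :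
    x = x' ∧ y = y' := by
  have : S.r (x, y) = S.r (x', y') := by rw [r_eq, r_eq, h1, h2]
  simpa using S.bijective.1 this

theorem pair_surj (u v : X) : ∃ x y, S.lam x y = u ∧ S.rho y x = v := by
  obtain ⟨⟨x, y⟩, h⟩ := S.bijective.2 (u, v)
  rw [r_eq, Prod.mk.injEq] at h
  exact ⟨x, y, h⟩

/-- Constructor from `λ` and `ρ`. -/
theorem braid_of {X : Type u} (l p : X → X → X)
    (h1 : ∀ x y z, l (l x y) (l (p y x) z) = l x (l y z))
    (h2 : ∀ x y z, p (l (p y x) z) (l x y) = l (p (l y z) x) (p z y))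
    (h3 : ∀ x y z, p z (p y x) = p (p z y) (p (l y z) x)) :
    let r : X × X → X × X := fun q => (l q.1 q.2, p q.2 q.1)
    onLeft r ∘ onRight r ∘ onLeft r = onRight r ∘ onLeft r ∘ onRight r := by
  intro r
  funext ⟨x, y, z⟩
  simp only [comp_apply, onLeft, onRight, r, Prod.mk.injEq]
  exact ⟨h1 x y z, h2 x y z, h3 x y z⟩

/-- The mirror image of a solution, obtained by conjugating `r` with the flip. -/
def mirror : Solution X where
  nonempty := S.nonempty
  r := fun q => (S.rho q.1 q.2, S.lam q.2 q.1)
  bijective := by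
    constructor
    · rintro ⟨x, y⟩ ⟨x', y'⟩ h
      simp only [Prod.mk.injEq] at h
      have := S.pair_inj h.2 h.1
      simp [this.1, this.2]
    · rintro ⟨u, v⟩
      obtain ⟨x, y, h1, h2⟩ := S.pair_surj v u
      exact ⟨(y, x), by simp [h1, h2]⟩
  lam_bijective := fun x => S.rho_bij x
  rho_bijective := fun y => S.lam_bij y
  braid := braid_of S.rho S.lam (fun x y z => (S.rho_rho z y x).symm)
    (fun x y z => (S.mid z y x).symm) (fun x y z => (S.lam_lam z y x).symm)

/-- The solution `(X, r⁻¹)`. -/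
noncomputable def inv : Solution X where
  nonempty := S.nonempty
  r := (Equiv.ofBijective S.r S.bijective).symm
  bijective := Equiv.bijective _
  lam_bijective := by
    intro u
    constructor
    · intro v v' h
      obtain ⟨x, y, h1, h2⟩ := S.pair_surj u v
      obtain ⟨x', y', h1', h2'⟩ := S.pair_surj u v'
      have e : (u, v) = Equiv.ofBijective S.r S.bijective (x, y) := by
        simp [r_eq, h1, h2]
      have e' : (u, v') = Equiv.ofBijective S.r S.bijective (x', y') := by
        simp [r_eq, h1', h2']
      simp only [e, e', Equiv.symm_apply_apply] at h
      subst h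
      rw [← h1'] at h1
      rw [← h2, ← h2', (S.lam_bij x).1 h1]
    · intro x
      obtain ⟨y, h⟩ := (S.lam_bij x).2 u
      refine ⟨S.rho y x, ?_⟩
      have e : (u, S.rho y x) = Equiv.ofBijective S.r S.bijective (x, y) := by
        simp [r_eq, h]
      simp only [e, Equiv.symm_apply_apply]
  rho_bijective := by
    intro v
    constructor
    · intro u u' h
      obtain ⟨x, y, h1, h2⟩ := S.pair_surj u v
      obtain ⟨x', y', h1', h2'⟩ := S.pair_surj u' v
      have e : (u, v) = Equiv.ofBijective S.r S.bijective (x, y) := by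
        simp [r_eq, h1, h2]
      have e' : (u', v) = Equiv.ofBijective S.r S.bijective (x', y') := by
        simp [r_eq, h1', h2']
      simp only [e, e', Equiv.symm_apply_apply] at h
      subst h
      rw [← h2'] at h2
      rw [← h1, ← h1', (S.rho_bij y).1 h2]
    · intro y
      obtain ⟨x, h⟩ := (S.rho_bij y).2 v
      refine ⟨S.lam x y, ?_⟩
      have e : (S.lam x y, v) = Equiv.ofBijective S.r S.bijective (x, y) := by
        simp [r_eq, h]
      simp only [e, Equiv.symm_apply_apply]
  braid := by
    have hl : ∀ t, onLeft (Equiv.ofBijective S.r S.bijective).symm (onLeft S.r t) = t := by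
      rintro ⟨x, y, z⟩
      have : (Equiv.ofBijective S.r S.bijective).symm (S.r (x, y)) = (x, y) :=
        Equiv.ofBijective_symm_apply_apply S.r S.bijective (x, y)
      simp [onLeft, this]
    have hr : ∀ t, onRight (Equiv.ofBijective S.r S.bijective).symm (onRight S.r t) = t := by
      rintro ⟨x, y, z⟩
      have : (Equiv.ofBijective S.r S.bijective).symm (S.r (y, z)) = (y, z) :=
        Equiv.ofBijective_symm_apply_apply S.r S.bijective (y, z)
      simp [onRight, this]
    have hl' : Surjective (onLeft S.r) := by
      rintro ⟨x, y, z⟩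
      obtain ⟨a, b, h1, h2⟩ := S.pair_surj x y
      exact ⟨(a, b, z), by simp [onLeft, r_eq, h1, h2]⟩
    have hr' : Surjective (onRight S.r) := by
      rintro ⟨x, y, z⟩
      obtain ⟨a, b, h1, h2⟩ := S.pair_surj y z
      exact ⟨(x, a, b), by simp [onRight, r_eq, h1, h2]⟩
    funext t
    obtain ⟨t, rfl⟩ := hl' t
    obtain ⟨t, rfl⟩ := hr' t
    obtain ⟨t, rfl⟩ := hl' t
    have h := congrFun S.braid t
    simp only [comp_apply] at h
    simp only [comp_apply, hl, hr]
    rw [h, hr, hl, hr]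

theorem inv_r (x y : X) : S.inv.r (S.lam x y, S.rho y x) = (x, y) :=
  Equiv.ofBijective_symm_apply_apply S.r S.bijective (x, y)

theorem inv_lam (x y : X) : S.inv.lam (S.lam x y) (S.rho y x) = x :=
  congrArg Prod.fst (S.inv_r x y)

theorem inv_rho (x y : X) : S.inv.rho (S.rho y x) (S.lam x y) = y :=
  congrArg Prod.snd (S.inv_r x y)

theorem ext_r {S S' : Solution X} (h : S.r = S'.r) : S = S' := by
  cases S
  cases S'
  cases h
  rfl

theorem inv_inv : S.inv.inv = S := by
  apply ext_r
  funext ⟨x, y⟩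
  have := S.inv.inv_r (S.lam x y) (S.rho y x)
  rwa [inv_lam, inv_rho] at this

/-! ### The retract -/

/-- `x ∼ y` if and only if `λ_x = λ_y` and `ρ_x = ρ_y`. -/
def retractSetoid : Setoid X where
  r x y := S.lam x = S.lam y ∧ S.rho x = S.rho y
  iseqv := ⟨fun _ => ⟨rfl, rfl⟩, fun h => ⟨h.1.symm, h.2.symm⟩,
    fun h k => ⟨h.1.trans k.1, h.2.trans k.2⟩⟩

theorem rel_iff (x y : X) : S.retractSetoid x y ↔ S.lam x = S.lam y ∧ S.rho x = S.rho y := Iff.rfl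

/-- `t ↦ λ_t⁻¹(t)` is injective, in relational form. -/
theorem diag_inj {z z' t : X} (h : S.lam z t = z) (h' : S.lam z' t = z') : z = z' := by
  obtain ⟨b, hb⟩ := (S.lam_bij t).2 t
  have key : ∀ z, S.lam z t = z → S.rho t z = S.lam t (S.rho b t) := by
    intro z h
    have hw : S.lam t = S.lam (S.rho t z) := by
      funext c
      have := S.lam_lam z t c
      rw [h] at this
      exact ((S.lam_bij z).1 this).symm
    have := S.mid z t b
    rw [h, ← hw, hb] at this
    rw [this, ← hw]
  exact (S.rho_bij t).1 ((key z h).trans (key z' h').symm)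

theorem rho_reflects {x y : X} (z : X)
    (h : S.retractSetoid (S.rho z x) (S.rho z y)) : S.retractSetoid x y := by
  rw [rel_iff] at h ⊢
  obtain ⟨hl, hr⟩ := h
  obtain ⟨t, ht⟩ := (S.lam_bij z).2 z
  have key : ∀ x, S.lam (S.lam x z) (S.lam (S.rho z x) t) = S.lam x z := by
    intro x
    rw [S.lam_lam, ht]
  have hu : S.lam x z = S.lam y z := by
    have h1 := key x
    have h2 := key y
    rw [← hl] at h2
    exact S.diag_inj h1 h2
  constructor
  · funext c
    obtain ⟨c, rfl⟩ := (S.lam_bij z).2 c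
    rw [← S.lam_lam x z c, ← S.lam_lam y z c, hu, hl]
  · funext c
    apply (S.rho_bij z).1
    rw [S.rho_rho c x z, S.rho_rho c y z, hu, hr]

theorem lam_reflects {x y : X} (z : X)
    (h : S.retractSetoid (S.lam z x) (S.lam z y)) : S.retractSetoid x y := by
  have := S.mirror.rho_reflects (x := x) (y := y) z ⟨h.2, h.1⟩
  exact ⟨this.2, this.1⟩

theorem lam_congr {x x' y y' : X} (hx : S.retractSetoid x x') (hy : S.retractSetoid y y') :
    S.retractSetoid (S.lam x y) (S.lam x' y') := by
  rw [rel_iff] at hx hy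
  rw [← hx.1]
  constructor
  · funext c
    obtain ⟨c, rfl⟩ := (S.lam_bij (S.rho y x)).2 c
    rw [S.lam_lam x y c, hy.2, S.lam_lam x y' c, hy.1]
  · funext c
    apply (S.rho_bij (S.rho y x)).1
    rw [← S.rho_rho c x y, hy.2, ← S.rho_rho c x y']

theorem rho_congr {x x' y y' : X} (hx : S.retractSetoid x x') (hy : S.retractSetoid y y') :
    S.retractSetoid (S.rho x y) (S.rho x' y') := by
  have := S.mirror.lam_congr (x := x) (x' := x') (y := y) (y' := y') ⟨hx.2, hx.1⟩ ⟨hy.2, hy.1⟩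
  exact ⟨this.2, this.1⟩

/-- `λ` on the quotient by `∼`. -/
def lamQ : Quotient S.retractSetoid → Quotient S.retractSetoid → Quotient S.retractSetoid :=
  Quotient.map₂ S.lam fun _ _ hx _ _ hy => S.lam_congr hx hy

/-- `ρ` on the quotient by `∼`. -/
def rhoQ : Quotient S.retractSetoid → Quotient S.retractSetoid → Quotient S.retractSetoid :=
  Quotient.map₂ S.rho fun _ _ hx _ _ hy => S.rho_congr hx hy

/-- The retract `Ret(X, r)`: the solution induced by `r` on `X / ∼`, that is
`r̄ (x̄, ȳ) = (class of λ_x(y), class of ρ_y(x))`. -/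
def retract : Solution (Quotient S.retractSetoid) where
  nonempty := S.nonempty.map (Quotient.mk _)
  r := fun q => (S.lamQ q.1 q.2, S.rhoQ q.2 q.1)
  bijective := by
    constructor
    · rintro ⟨⟨x⟩, ⟨y⟩⟩ ⟨⟨x'⟩, ⟨y'⟩⟩ h
      obtain ⟨h1, h2⟩ := Prod.mk.inj h
      have h1 : S.retractSetoid (S.lam x y) (S.lam x' y') := Quotient.exact h1
      have h2 : S.retractSetoid (S.rho y x) (S.rho y' x') := Quotient.exact h2
      obtain ⟨y₂, hy⟩ := (S.lam_bij x).2 (S.lam x' y')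
      rw [← hy] at h1
      have hyy := S.lam_reflects x h1
      obtain ⟨x₂, hx⟩ := (S.rho_bij y').2 (S.rho y x)
      rw [← hx] at h2
      have hxx := S.rho_reflects y' h2
      obtain ⟨e1, e2⟩ : x = x₂ ∧ y₂ = y' := by
        apply S.pair_inj
        · rw [hy, hxx.1]
        · rw [hx, hyy.2]
      refine Prod.ext (Quotient.sound ?_) (Quotient.sound ?_)
      · rw [e1]; exact hxx
      · rw [← e2]; exact hyy
    · rintro ⟨⟨u⟩, ⟨v⟩⟩
      obtain ⟨x, y, rfl, rfl⟩ := S.pair_surj u v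
      exact ⟨(Quotient.mk _ x, Quotient.mk _ y), rfl⟩
  lam_bijective := by
    rintro ⟨x⟩
    constructor
    · rintro ⟨y⟩ ⟨y'⟩ h
      exact Quotient.sound (S.lam_reflects x (Quotient.exact h))
    · rintro ⟨u⟩
      obtain ⟨y, rfl⟩ := (S.lam_bij x).2 u
      exact ⟨Quotient.mk _ y, rfl⟩
  rho_bijective := by
    rintro ⟨y⟩
    constructor
    · rintro ⟨x⟩ ⟨x'⟩ h
      exact Quotient.sound (S.rho_reflects y (Quotient.exact h))
    · rintro ⟨u⟩
      obtain ⟨x, rfl⟩ := (S.rho_bij y).2 u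
      exact ⟨Quotient.mk _ x, rfl⟩
  braid := by
    apply braid_of S.lamQ S.rhoQ
    · rintro ⟨x⟩ ⟨y⟩ ⟨z⟩
      exact congrArg (Quotient.mk _) (S.lam_lam x y z)
    · rintro ⟨x⟩ ⟨y⟩ ⟨z⟩
      exact congrArg (Quotient.mk _) (S.mid x y z)
    · rintro ⟨x⟩ ⟨y⟩ ⟨z⟩
      exact congrArg (Quotient.mk _) (S.rho_rho x y z)

/-- `Retⁿ(X, r)`, together with its underlying set. -/
def iterRetract : ℕ → (Y : Type u) × Solution Y
  | 0 => ⟨X, S⟩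
  | n + 1 => ⟨_, (iterRetract n).2.retract⟩

/-- `(X, r)` is a multipermutation solution of level `m`: the underlying set of `Ret^m(X, r)` has
one element and, if `m` is positive, that of `Ret^(m-1)(X, r)` has more than one. -/
def HasLevel (m : ℕ) : Prop :=
  Cardinal.mk (S.iterRetract m).1 = 1 ∧ (0 < m → 1 < Cardinal.mk (S.iterRetract (m - 1)).1)

/-- `(X, r)` is of finite multipermutation level. -/
def FiniteLevel : Prop := ∃ m, S.HasLevel m

/-! ### Monoids generated by a solution -/

/-- A common description of the structure monoid and of the structure group, used to construct both
extensions of `r` at once. -/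
structure IsEnvelope {H : Type u} [Monoid H] (ι : X → H) : Prop where
  rel : ∀ x y, ι x * ι y = ι (S.lam x y) * ι (S.rho y x)
  ind : ∀ P : H → Prop, P 1 → (∀ x h, P h → P (ι x * h)) →
    (∀ x h, (∀ y, IsUnit (ι y)) → P (ι x * h) → P h) → ∀ h, P h
  lift : ∀ (W : Type u) [Monoid W] (T : X → W),
    (∀ x y, T x * T y = T (S.lam x y) * T (S.rho y x)) →
    ((∀ x, IsUnit (ι x)) → ∀ x, IsUnit (T x)) → ∃ f : H →* W, ∀ x, f (ι x) = T x

/-- The laws of the extension of `r` to a monoid `H` with canonical map `ι : X → H`. Here `L a` is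
`λ_a : H → H` and `R a` is `ρ_a : H → H`. -/
structure IsExtension {H : Type u} [Monoid H] (ι : X → H) (L R : H → H → H) : Prop where
  lam_gen : ∀ x y, L (ι x) (ι y) = ι (S.lam x y)
  rho_gen : ∀ x y, R (ι y) (ι x) = ι (S.rho y x)
  lam_one : ∀ c, L 1 c = c
  lam_mul : ∀ a b c, L (a * b) c = L a (L b c)
  lam_unit : ∀ a, L a 1 = 1
  lam_prod : ∀ a b c, L a (b * c) = L a b * L (R b a) c
  rho_one : ∀ c, R 1 c = c
  rho_mul : ∀ a b c, R (a * b) c = R b (R a c)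
  rho_unit : ∀ a, R a 1 = 1
  rho_prod : ∀ a b c, R a (b * c) = R (L c a) b * R a c
  mul_eq : ∀ a b, a * b = L a b * R b a

/-- Auxiliary monoid: letters push a state in `X` and write a word in `H`. -/
def Push (X H : Type u) : Type u := X → H × X

instance {X H : Type u} [Monoid H] : Monoid (Push X H) where
  one := fun x => (1, x)
  mul f g := fun x => ((f x).1 * (g (f x).2).1, (g (f x).2).2)
  mul_assoc f g k := by
    funext x
    exact Prod.ext (mul_assoc _ _ _) rfl
  one_mul f := by
    funext x
    exact Prod.ext (one_mul _) rfl
  mul_one f := by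
    funext x
    exact Prod.ext (mul_one _) rfl

theorem Push.one_apply {X H : Type u} [Monoid H] (x : X) : (1 : Push X H) x = (1, x) := rfl

theorem Push.mul_apply {X H : Type u} [Monoid H] (f g : Push X H) (x : X) :
    (f * g) x = ((f x).1 * (g (f x).2).1, (g (f x).2).2) := rfl

theorem Push.isUnit {X H : Type u} [Monoid H] (f : Push X H) (h1 : ∀ x, IsUnit (f x).1)
    (h2 : Bijective fun x => (f x).2) : IsUnit f := by
  choose u hu using h1
  obtain ⟨g, hl, hr⟩ := bijective_iff_has_inverse.1 h2
  refine ⟨⟨f, fun x => (((u (g x))⁻¹ : Hˣ), g x), ?_, ?_⟩, rfl⟩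
  · funext x
    have := hl x
    simp only at this
    change ((f x).1 * ((u (g (f x).2))⁻¹ : Hˣ), g (f x).2) = (1, x)
    rw [this, ← hu, Units.mul_inv]
  · funext x
    have := hr x
    simp only at this
    change (((u (g x))⁻¹ : Hˣ) * (f (g x)).1, (f (g x)).2) = (1, x)
    rw [this, ← hu, Units.inv_mul]

/-- Auxiliary monoid: elements act on `H` from the left and write a word in `H` on the right. -/
def Pull (H : Type u) : Type u := H → H × H

instance {H : Type u} [Monoid H] : Monoid (Pull H) where
  one := fun m => (m, 1)
  mul f g := fun m => ((f (g m).1).1, (f (g m).1).2 * (g m).2)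
  mul_assoc f g k := by
    funext x
    exact Prod.ext rfl (mul_assoc _ _ _)
  one_mul f := by
    funext x
    exact Prod.ext rfl (one_mul _)
  mul_one f := by
    funext x
    exact Prod.ext rfl (mul_one _)

theorem Pull.one_apply {H : Type u} [Monoid H] (m : H) : (1 : Pull H) m = (m, 1) := rfl

theorem Pull.mul_apply {H : Type u} [Monoid H] (f g : Pull H) (m : H) :
    (f * g) m = ((f (g m).1).1, (f (g m).1).2 * (g m).2) := rfl

theorem Pull.isUnit {H : Type u} [Monoid H] (f : Pull H) (h1 : ∀ x, IsUnit (f x).2)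
    (h2 : Bijective fun x => (f x).1) : IsUnit f := by
  choose u hu using h1
  obtain ⟨g, hl, hr⟩ := bijective_iff_has_inverse.1 h2
  refine ⟨⟨f, fun x => (g x, ((u (g x))⁻¹ : Hˣ)), ?_, ?_⟩, rfl⟩
  · funext x
    have := hr x
    simp only at this
    change ((f (g x)).1, (f (g x)).2 * ((u (g x))⁻¹ : Hˣ)) = (x, 1)
    rw [this, ← hu, Units.mul_inv]
  · funext x
    have := hl x
    simp only at this
    change (g (f x).1, ((u (g (f x).1))⁻¹ : Hˣ) * (f x).2) = (x, 1)
    rw [this, ← hu, Units.inv_mul]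

section Envelope

variable {S} {H : Type u} [Monoid H] {ι : X → H}

theorem IsEnvelope.exists_push (E : S.IsEnvelope ι) :
    ∃ T : H →* Push X H, ∀ x y, T (ι y) x = (ι (S.lam x y), S.rho y x) := by
  obtain ⟨f, hf⟩ := E.lift (Push X H) (fun y x => (ι (S.lam x y), S.rho y x)) (by
      intro y z
      funext x
      refine (Push.mul_apply _ _ _).trans (Eq.trans ?_ (Push.mul_apply _ _ _).symm)
      simp only
      rw [E.rel, S.lam_lam, S.mid, S.rho_rho]) (by
      intro h x
      exact Push.isUnit _ (fun _ => h _) (S.rho_bij x))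
  exact ⟨f, fun x y => congrFun (hf y) x⟩

theorem IsEnvelope.exists_pushInv (E : S.IsEnvelope ι) :
    ∃ T : H →* Push X H, ∀ x y, T (ι (S.lam x y)) x = (ι y, S.rho y x) := by
  choose li hli using fun x => (S.lam_bij x).2
  have hli' : ∀ x y, li x (S.lam x y) = y := fun x y => (S.lam_bij x).1 (hli x _)
  obtain ⟨f, hf⟩ := E.lift (Push X H) (fun u x => (ι (li x u), S.rho (li x u) x)) (by
      intro u w
      funext x
      refine (Push.mul_apply _ _ _).trans (Eq.trans ?_ (Push.mul_apply _ _ _).symm)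
      simp only
      obtain ⟨y, rfl⟩ := (S.lam_bij x).2 u
      rw [hli']
      obtain ⟨z, rfl⟩ := (S.lam_bij (S.rho y x)).2 w
      rw [hli', S.lam_lam, hli', S.mid, hli', ← S.rho_rho, E.rel y z]) (by
      intro h u
      refine Push.isUnit _ (fun _ => h _) ⟨?_, ?_⟩
      · intro x x' e
        exact (S.pair_inj (by rw [hli, hli]) e).1
      · intro v
        obtain ⟨x, y, rfl, rfl⟩ := S.pair_surj u v
        exact ⟨x, by simp only [hli']⟩)
  refine ⟨f, fun x y => ?_⟩
  rw [hf]
  simp only [hli']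

theorem IsEnvelope.push_bijective (E : S.IsEnvelope ι) (T : H →* Push X H)
    (hT : ∀ x y, T (ι y) x = (ι (S.lam x y), S.rho y x)) (x : X) :
    Bijective fun h => (T h x).1 := by
  obtain ⟨T', hT'⟩ := E.exists_pushInv
  have h1 : ∀ h x, T' (T h x).1 x = (h, (T h x).2) := by
    apply E.ind
    · intro x
      simp [Push.one_apply]
    · intro y h ih x
      simp only [map_mul, Push.mul_apply, hT, hT', ih]
    · intro y h hu ih v
      obtain ⟨x, rfl⟩ := (S.rho_bij y).2 v
      have := ih x
      simp only [map_mul, Push.mul_apply, hT, hT', Prod.mk.injEq] at this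
      exact Prod.ext ((hu _).mul_left_cancel this.1) this.2
  have h2 : ∀ h x, T (T' h x).1 x = (h, (T' h x).2) := by
    apply E.ind
    · intro x
      simp [Push.one_apply]
    · intro u h ih x
      obtain ⟨y, rfl⟩ := (S.lam_bij x).2 u
      simp only [map_mul, Push.mul_apply, hT, hT', ih]
    · intro u h hu ih v
      obtain ⟨x, y, rfl, rfl⟩ := S.pair_surj u v
      have := ih x
      simp only [map_mul, Push.mul_apply, hT, hT', Prod.mk.injEq] at this
      exact Prod.ext ((hu _).mul_left_cancel this.1) this.2
  exact bijective_iff_has_inverse.2 ⟨fun h => (T' h x).1,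
    fun h => congrArg Prod.fst (h1 h x), fun h => congrArg Prod.fst (h2 h x)⟩

theorem IsEnvelope.push_swap (E : S.IsEnvelope ι) (T : H →* Push X H)
    (hT : ∀ x y, T (ι y) x = (ι (S.lam x y), S.rho y x)) : ∀ m x y,
    (T (T m (S.rho y x)).1 (S.lam x y)).1 = (T (T m y).1 x).1 ∧
    (T (T m (S.rho y x)).1 (S.lam x y)).2 = S.lam (T (T m y).1 x).2 (T m y).2 ∧
    (T m (S.rho y x)).2 = S.rho (T m y).2 (T (T m y).1 x).2 := by
  apply E.ind
  · intro x y
    simp [Push.one_apply]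
  · intro z h ih x y
    obtain ⟨i1, i2, i3⟩ := ih (S.rho (S.lam y z) x) (S.rho z y)
    simp only [map_mul, Push.mul_apply, hT]
    rw [S.lam_lam, S.mid, S.rho_rho, i1]
    exact ⟨rfl, i2, i3⟩
  · intro z h hu ih x₁ y₁
    obtain ⟨y, rfl⟩ := (S.rho_bij z).2 y₁
    obtain ⟨x, rfl⟩ := (S.rho_bij (S.lam y z)).2 x₁
    obtain ⟨i1, i2, i3⟩ := ih x y
    simp only [map_mul, Push.mul_apply, hT] at i1 i2 i3
    rw [S.lam_lam, S.mid, S.rho_rho] at i1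
    rw [S.mid, S.rho_rho] at i2
    rw [S.rho_rho] at i3
    exact ⟨(hu _).mul_left_cancel i1, i2, i3⟩

theorem IsEnvelope.exists_extension (E : S.IsEnvelope ι) :
    ∃ L R, S.IsExtension ι L R ∧
      ∀ a, Bijective (L a) := by
  obtain ⟨T, hT⟩ := E.exists_push
  obtain ⟨V, hV⟩ := E.lift (Pull H) (fun x m => ((T m x).1, ι (T m x).2)) (by
      intro x y
      funext m
      refine (Pull.mul_apply _ _ _).trans (Eq.trans ?_ (Pull.mul_apply _ _ _).symm)
      obtain ⟨i1, i2, i3⟩ := E.push_swap T hT m x y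
      simp only
      rw [i1, i2, i3, ← E.rel]) (by
      intro h x
      exact Pull.isUnit _ (fun _ => h _) (E.push_bijective T hT x))
  have hV' : ∀ x m, V (ι x) m = ((T m x).1, ι (T m x).2) := fun x m => congrFun (hV x) m
  have Tinj : ∀ x {h k : H}, (T h x).1 = (T k x).1 → h = k := fun x _ _ e =>
    (E.push_bijective T hT x).1 e
  have V1 : ∀ x h m, (V (ι x * h) m).1 = (T (V h m).1 x).1 := by
    intro x h m
    rw [map_mul, Pull.mul_apply, hV']
  have V2 : ∀ x h m, (V (ι x * h) m).2 = ι (T (V h m).1 x).2 * (V h m).2 := by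
    intro x h m
    rw [map_mul, Pull.mul_apply, hV']
  have Tmul1 : ∀ a b x, (T (a * b) x).1 = (T a x).1 * (T b (T a x).2).1 := by
    intro a b x
    rw [map_mul, Push.mul_apply]
  have Tmul2 : ∀ a b x, (T (a * b) x).2 = (T b (T a x).2).2 := by
    intro a b x
    rw [map_mul, Push.mul_apply]
  have T1 : ∀ x, T 1 x = (1, x) := by
    intro x
    rw [map_one, Push.one_apply]
  have unit1 : ∀ a, V a 1 = (1, a) := by
    apply E.ind
    · rw [map_one, Pull.one_apply]
    · intro x a ih
      refine Prod.ext ?_ ?_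
      · rw [V1, ih, T1]
      · rw [V2, ih, T1]
    · intro x a hu ih
      have h1 : (V a 1).1 = 1 := by
        apply Tinj x
        rw [← V1, ih, T1]
      have h2 := V2 x a 1
      rw [ih, h1, T1] at h2
      exact Prod.ext h1 ((hu _).mul_left_cancel h2).symm
  have prod : ∀ a m m', (V a (m * m')).1 = (V a m).1 * (V (V a m).2 m').1 ∧
      (V a (m * m')).2 = (V (V a m).2 m').2 := by
    apply E.ind
    · intro m m'
      simp [Pull.one_apply]
    · intro x a ih m m'
      obtain ⟨i1, i2⟩ := ih m m'
      rw [V1, V1, V2, V2, V1, V2, i1, i2, Tmul1, Tmul2]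
      exact ⟨rfl, rfl⟩
    · intro x a hu ih m m'
      obtain ⟨i1, i2⟩ := ih m m'
      rw [V1, V1, V2, V1, ← Tmul1] at i1
      have i1 := Tinj x i1
      rw [V2, V2, V2, i1, Tmul2] at i2
      exact ⟨i1, (hu _).mul_left_cancel i2⟩
  have meq : ∀ m x, ι x * m = (T m x).1 * ι (T m x).2 := by
    apply E.ind
    · intro x
      rw [T1]; simp
    · intro y m ih x
      rw [Tmul1, Tmul2, hT, mul_assoc, ← ih, ← mul_assoc, ← mul_assoc, E.rel]
    · intro y m hu ih x'
      obtain ⟨x, rfl⟩ := (S.rho_bij y).2 x'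
      have := ih x
      rw [Tmul1, Tmul2, hT, mul_assoc, ← mul_assoc, E.rel, mul_assoc] at this
      exact (hu _).mul_left_cancel this
  refine ⟨fun a c => (V a c).1, fun c a => (V a c).2, ⟨?_, ?_, ?_, ?_, ?_, ?_, ?_, ?_, ?_, ?_, ?_⟩,
    ?_⟩
  · intro x y
    simp only [hV', hT]
  · intro x y
    simp only [hV', hT]
  · intro c
    simp only [map_one, Pull.one_apply]
  · intro a b c
    simp only [map_mul, Pull.mul_apply]
  · intro a
    simp only [unit1]
  · intro a b c
    exact (prod a b c).1
  · intro c
    simp only [unit1]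
  · intro a b c
    exact (prod c a b).2
  · intro a
    simp only [map_one, Pull.one_apply]
  · intro a b c
    simp only [map_mul, Pull.mul_apply]
  · apply E.ind
    · intro b
      simp [Pull.one_apply]
    · intro x a ih b
      have ih : a * b = (V a b).1 * (V a b).2 := ih b
      rw [V1, V2, ← mul_assoc, ← meq, mul_assoc, mul_assoc, ← ih]
    · intro x a hu ih b
      have : ι x * a * b = (V (ι x * a) b).1 * (V (ι x * a) b).2 := ih b
      rw [V1, V2, ← mul_assoc, ← meq, mul_assoc, mul_assoc] at this
      exact (hu _).mul_left_cancel this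
  · have hcomp : ∀ x a, (fun c => (V (ι x * a) c).1) =
        (fun m => (T m x).1) ∘ fun c => (V a c).1 := by
      intro x a
      funext m
      exact V1 x a m
    apply E.ind
    · simp only [map_one, Pull.one_apply]
      exact bijective_id
    · intro x a ih
      simp only [hcomp]
      exact (E.push_bijective T hT x).comp ih
    · intro x a hu ih
      simp only [hcomp] at ih
      exact (Bijective.of_comp_iff' (E.push_bijective T hT x) _).1 ih

theorem IsEnvelope.isUnit (E : S.IsEnvelope ι) (hu : ∀ y, IsUnit (ι y)) : ∀ h : H, IsUnit h :=
  E.ind (fun h => IsUnit h) isUnit_one (fun x _ hh => (hu x).mul hh)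
    (fun x h _ hh => by
      have := (hu x).unit⁻¹.isUnit.mul hh
      rwa [← mul_assoc, IsUnit.val_inv_mul, one_mul] at this)

theorem IsExtension.lam_inj {L R : H → H → H} (h : S.IsExtension ι L R) {a : H} (ha : IsUnit a)
    {b c : H} (e : L a b = L a c) : b = c := by
  obtain ⟨u, rfl⟩ := ha
  have := congrArg (L ((u⁻¹ : Hˣ) : H)) e
  rwa [← h.lam_mul, ← h.lam_mul, Units.inv_mul, h.lam_one, h.lam_one] at this

theorem IsExtension.unique (E : S.IsEnvelope ι) {L R L' R' : H → H → H}
    (h : S.IsExtension ι L R) (h' : S.IsExtension ι L' R') : L = L' ∧ R = R' := by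
  have key : ∀ m x, L (ι x) m = L' (ι x) m ∧ R m (ι x) = R' m (ι x) := by
    apply E.ind
    · intro x
      rw [h.lam_unit, h'.lam_unit, h.rho_one, h'.rho_one]
      exact ⟨rfl, rfl⟩
    · intro y m ih x
      rw [h.lam_prod, h'.lam_prod, h.rho_mul, h'.rho_mul, h.lam_gen, h'.lam_gen, h.rho_gen,
        h'.rho_gen, (ih _).1, (ih _).2]
      exact ⟨rfl, rfl⟩
    · intro y m hu ih x'
      obtain ⟨x, rfl⟩ := (S.rho_bij y).2 x'
      have := ih x
      rw [h.lam_prod, h'.lam_prod, h.rho_mul, h'.rho_mul, h.lam_gen, h'.lam_gen, h.rho_gen,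
        h'.rho_gen] at this
      exact ⟨(hu _).mul_left_cancel this.1, this.2⟩
  have main : ∀ a m, L a m = L' a m ∧ R m a = R' m a := by
    apply E.ind
    · intro m
      rw [h.lam_one, h'.lam_one, h.rho_unit, h'.rho_unit]
      exact ⟨rfl, rfl⟩
    · intro x a ih m
      rw [h.lam_mul, h'.lam_mul, h.rho_prod, h'.rho_prod, (ih m).1, (ih m).2, (key _ x).1,
        (key _ x).2]
      exact ⟨rfl, rfl⟩
    · intro x a hu ih m
      have hall := E.isUnit hu
      have := ih m
      rw [h.lam_mul, h'.lam_mul, h.rho_prod, h'.rho_prod, ← (key _ x).1] at this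
      have h1 := h.lam_inj (hu x) this.1
      rw [h1, (key _ x).2] at this
      exact ⟨h1, (hall _).mul_left_cancel this.2⟩
  exact ⟨funext fun a => funext fun m => (main a m).1, funext fun m => funext fun a => (main a m).2⟩

theorem IsEnvelope.mirror (E : S.IsEnvelope ι) :
    S.mirror.IsEnvelope (fun x => MulOpposite.op (ι x)) where
  rel := fun x y => congrArg MulOpposite.op (E.rel y x)
  ind := by
    intro P h1 hx hu h
    have key : ∀ h k, P k → P (MulOpposite.op h * k) := by
      apply E.ind
      · intro k hk
        simpa using hk
      · intro x h ih k hk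
        rw [MulOpposite.op_mul, mul_assoc]
        exact ih _ (hx _ _ hk)
      · intro x h hall ih k hk
        obtain ⟨u, hu'⟩ := (hall x).op
        have e : k = MulOpposite.op (ι x) * ((u⁻¹ : (Hᵐᵒᵖ)ˣ) * k) := by
          rw [← hu', Units.mul_inv_cancel_left]
        have hk' : P ((u⁻¹ : (Hᵐᵒᵖ)ˣ) * k) := by
          refine hu x _ (fun y => (hall y).op) ?_
          rw [← e]
          exact hk
        have := ih _ hk'
        rwa [MulOpposite.op_mul, mul_assoc, ← e] at this
    simpa using key h.unop 1 h1
  lift := by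
    intro W _ T hT hu
    obtain ⟨f, hf⟩ := E.lift (Wᵐᵒᵖ) (fun x => MulOpposite.op (T x))
      (fun x y => congrArg MulOpposite.op (hT y x))
      (fun h x => (hu (fun y => (h y).op) x).op)
    refine ⟨⟨⟨fun h => (f h.unop).unop, by simp⟩, by simp⟩, fun x => ?_⟩
    exact congrArg MulOpposite.unop (hf x)

theorem IsEnvelope.inv (E : S.IsEnvelope ι) : S.inv.IsEnvelope ι where
  rel := by
    intro u v
    obtain ⟨x, y, rfl, rfl⟩ := S.pair_surj u v
    rw [inv_lam, inv_rho, E.rel x y]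
  ind := E.ind
  lift := by
    intro W _ T hT hu
    refine E.lift W T ?_ hu
    intro x y
    have := hT (S.lam x y) (S.rho y x)
    rw [inv_lam, inv_rho] at this
    exact this.symm

theorem IsExtension.mirror {L R : H → H → H} (h : S.IsExtension ι L R) :
    S.mirror.IsExtension (fun x => MulOpposite.op (ι x))
      (fun a c => MulOpposite.op (R a.unop c.unop)) (fun a c => MulOpposite.op (L a.unop c.unop)) where
  lam_gen _ _ := congrArg MulOpposite.op (h.rho_gen _ _)
  rho_gen _ _ := congrArg MulOpposite.op (h.lam_gen _ _)
  lam_one _ := congrArg MulOpposite.op (h.rho_one _)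
  lam_mul _ _ _ := congrArg MulOpposite.op (h.rho_mul _ _ _)
  lam_unit _ := congrArg MulOpposite.op (h.rho_unit _)
  lam_prod _ _ _ := congrArg MulOpposite.op (h.rho_prod _ _ _)
  rho_one _ := congrArg MulOpposite.op (h.lam_one _)
  rho_mul _ _ _ := congrArg MulOpposite.op (h.lam_mul _ _ _)
  rho_unit _ := congrArg MulOpposite.op (h.lam_unit _)
  rho_prod _ _ _ := congrArg MulOpposite.op (h.lam_prod _ _ _)
  mul_eq _ _ := congrArg MulOpposite.op (h.mul_eq _ _)

theorem IsExtension.lam_bijective {L R : H → H → H} (h : S.IsExtension ι L R)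
    (E : S.IsEnvelope ι) (a : H) : Bijective (L a) := by
  obtain ⟨L₀, R₀, h₀, hb⟩ := E.exists_extension
  rw [(h.unique E h₀).1]
  exact hb a

theorem IsExtension.rho_bijective {L R : H → H → H} (h : S.IsExtension ι L R)
    (E : S.IsEnvelope ι) (a : H) : Bijective (R a) := by
  have hb := h.mirror.lam_bijective E.mirror (MulOpposite.op a)
  exact MulOpposite.unop_bijective.comp (hb.comp MulOpposite.op_bijective)

theorem IsExtension.inv_apply {L R L' R' : H → H → H} (h : S.IsExtension ι L R)
    (E : S.IsEnvelope ι) (h' : S.inv.IsExtension ι L' R') :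
    ∀ a c, L' (L a c) (R c a) = a ∧ R' (R c a) (L a c) = c := by
  have gen1 : ∀ x y, L' (ι (S.lam x y)) (ι (S.rho y x)) = ι x := by
    intro x y
    rw [h'.lam_gen, inv_lam]
  have gen2 : ∀ x y, R' (ι (S.rho y x)) (ι (S.lam x y)) = ι y := by
    intro x y
    rw [h'.rho_gen, inv_rho]
  have key : ∀ c x, L' (L (ι x) c) (R c (ι x)) = ι x ∧ R' (R c (ι x)) (L (ι x) c) = c := by
    apply E.ind
    · intro x
      rw [h.lam_unit, h.rho_one, h'.lam_one, h'.rho_unit]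
      exact ⟨rfl, rfl⟩
    · intro y c ih x
      obtain ⟨i1, i2⟩ := ih (S.rho y x)
      rw [h.lam_prod, h.rho_mul, h.lam_gen, h.rho_gen, h'.lam_mul, h'.rho_prod, i1, i2, gen1, gen2]
      exact ⟨rfl, rfl⟩
    · intro y c hu ih x'
      obtain ⟨x, rfl⟩ := (S.rho_bij y).2 x'
      have := ih x
      rw [h.lam_prod, h.rho_mul, h.lam_gen, h.rho_gen, h'.lam_mul, h'.rho_prod] at this
      have e := h'.lam_inj (hu _) (this.1.trans (gen1 x y).symm)
      rw [e, gen2] at this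
      exact ⟨e, (hu _).mul_left_cancel this.2⟩
  apply E.ind
  · intro c
    rw [h.lam_one, h.rho_unit, h'.lam_unit, h'.rho_one]
    exact ⟨rfl, rfl⟩
  · intro x a ih c
    obtain ⟨i1, i2⟩ := ih c
    obtain ⟨k1, k2⟩ := key (L a c) x
    rw [h.lam_mul, h.rho_prod, h'.lam_prod, h'.rho_mul, k1, k2, i1, i2]
    exact ⟨rfl, rfl⟩
  · intro x a hu ih c
    have := ih c
    obtain ⟨k1, k2⟩ := key (L a c) x
    rw [h.lam_mul, h.rho_prod, h'.lam_prod, h'.rho_mul, k1, k2] at this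
    exact ⟨(hu _).mul_left_cancel this.1, this.2⟩

theorem IsExtension.mid {L R : H → H → H} (h : S.IsExtension ι L R) (E : S.IsEnvelope ι) :
    ∀ a b c, R (L (R b a) c) (L a b) = L (R (L b c) a) (R c b) := by
  have ll : ∀ a b c, L (L a b) (L (R b a) c) = L a (L b c) := by
    intro a b c
    rw [← h.lam_mul, ← h.mul_eq, h.lam_mul]
  have rr : ∀ a b c, R c (R b a) = R (R c b) (R (L b c) a) := by
    intro a b c
    rw [← h.rho_mul, ← h.rho_mul, ← h.mul_eq]
  have s1 : ∀ c x y, R (L (R (ι y) (ι x)) c) (L (ι x) (ι y)) =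
      L (R (L (ι y) c) (ι x)) (R c (ι y)) := by
    apply E.ind
    · intro x y
      simp only [h.lam_unit, h.rho_one]
    · intro z c ih x y
      have := ih (S.rho (S.lam y z) x) (S.rho z y)
      simp only [h.lam_gen, h.rho_gen, h.lam_prod, h.rho_mul] at this ⊢
      rw [S.mid, S.rho_rho, this]
    · intro z c hu ih x₁ y₁
      obtain ⟨y, rfl⟩ := (S.rho_bij z).2 y₁
      obtain ⟨x, rfl⟩ := (S.rho_bij (S.lam y z)).2 x₁
      have := ih x y
      simp only [h.lam_gen, h.rho_gen, h.lam_prod, h.rho_mul] at this ⊢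
      rw [S.mid, S.rho_rho] at this
      exact this
  have aux : ∀ x y b c, L (R (L (ι y * b) c) (ι x)) (R c (ι y * b)) =
      R (L (R (ι y) (ι x)) (L b c)) (L (ι x) (ι y)) *
        L (R (L b c) (R (ι y) (ι x))) (R c b) := by
    intro x y b c
    rw [h.rho_prod, h.lam_prod, h.lam_mul, ← s1, ← rr]
  have aux' : ∀ x y b c, R (L (R (ι y * b) (ι x)) c) (L (ι x) (ι y * b)) =
      R (L (R (ι y) (ι x)) (L b c)) (L (ι x) (ι y)) *
        R (L (R b (R (ι y) (ι x))) c) (L (R (ι y) (ι x)) b) := by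
    intro x y b c
    rw [h.lam_prod, h.rho_mul, h.rho_prod, ll]
  have s2 : ∀ b x c, R (L (R b (ι x)) c) (L (ι x) b) = L (R (L b c) (ι x)) (R c b) := by
    apply E.ind
    · intro x c
      simp only [h.lam_unit, h.rho_unit, h.lam_one, h.rho_one]
    · intro y b ih x c
      rw [aux, aux', h.rho_gen, ih]
    · intro y b hu ih x' c
      obtain ⟨x, rfl⟩ := (S.rho_bij y).2 x'
      have := ih x c
      rw [aux, aux', h.rho_gen] at this
      exact (E.isUnit hu _).mul_left_cancel this
  have aux2 : ∀ x a b c, R (L (R b (ι x * a)) c) (L (ι x * a) b) =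
      L (R (L a (L b c)) (ι x)) (R (L (R b a) c) (L a b)) := by
    intro x a b c
    rw [h.rho_prod, h.lam_mul, h.lam_mul, s2, ll]
  have aux3 : ∀ x a b c, L (R (L b c) (ι x * a)) (R c b) =
      L (R (L a (L b c)) (ι x)) (L (R (L b c) a) (R c b)) := by
    intro x a b c
    rw [h.rho_prod, h.lam_mul]
  apply E.ind
  · intro b c
    simp only [h.rho_unit, h.lam_one]
  · intro x a ih b c
    rw [aux2, aux3, ih]
  · intro x a hu ih b c
    have := ih b c
    rw [aux2, aux3] at this
    exact h.lam_inj (E.isUnit hu _) this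

theorem IsEnvelope.existsUnique_extension (E : S.IsEnvelope ι) :
    ∃! p : (H → H → H) × (H → H → H), S.IsExtension ι p.1 p.2 := by
  obtain ⟨L, R, h, -⟩ := E.exists_extension
  refine ⟨(L, R), h, fun p hp => ?_⟩
  obtain ⟨h1, h2⟩ := hp.unique E h
  exact Prod.ext h1 h2

/-- An extension of `r` to `H` is a solution `r_H (a, b) = (λ_a(b), ρ_b(a))`. -/
def IsExtension.solution {L R : H → H → H} (h : S.IsExtension ι L R) (E : S.IsEnvelope ι) :
    Solution H where
  nonempty := ⟨1⟩
  r := fun p => (L p.1 p.2, R p.2 p.1)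
  bijective := by
    obtain ⟨L', R', h', -⟩ := E.inv.exists_extension
    have h1 := h.inv_apply E h'
    have h2 := h'.inv_apply (L' := L) (R' := R) E.inv (by rw [inv_inv]; exact h)
    exact bijective_iff_has_inverse.2 ⟨fun p => (L' p.1 p.2, R' p.2 p.1),
      fun p => Prod.ext (h1 p.1 p.2).1 (h1 p.1 p.2).2,
      fun p => Prod.ext (h2 p.1 p.2).1 (h2 p.1 p.2).2⟩
  lam_bijective := h.lam_bijective E
  rho_bijective := h.rho_bijective E
  braid := by
    refine braid_of L R (fun a b c => ?_) (h.mid E) (fun a b c => ?_)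
    · rw [← h.lam_mul, ← h.mul_eq, h.lam_mul]
    · rw [← h.rho_mul, ← h.rho_mul, ← h.mul_eq]

end Envelope

/-! ### The structure monoid -/

/-- The structure monoid `M(X, r) = ⟨X ∣ x ∘ y = λ_x(y) ∘ ρ_y(x)⟩`. -/
abbrev StructureMonoid : Type u :=
  PresentedMonoid (fun a b : FreeMonoid X => ∃ x y,
    a = FreeMonoid.of x * FreeMonoid.of y ∧
    b = FreeMonoid.of (S.lam x y) * FreeMonoid.of (S.rho y x))

/-- The canonical map `X → M(X, r)`. -/
def toMonoid (x : X) : S.StructureMonoid := PresentedMonoid.of _ x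

theorem isEnvelope_toMonoid : S.IsEnvelope S.toMonoid where
  rel x y := PresentedMonoid.mk_eq_mk_of_rel ⟨x, y, rfl, rfl⟩
  ind := by
    intro P h1 hx _ h
    obtain ⟨w, rfl⟩ := PresentedMonoid.surjective_mk h
    induction w using FreeMonoid.recOn with
    | one => exact h1
    | of_mul x w ih => exact hx x _ ih
  lift := by
    intro W _ T hT _
    refine ⟨PresentedMonoid.lift T ?_, fun x => rfl⟩
    rintro a b ⟨x, y, rfl, rfl⟩
    simpa using hT x y

/-- There is exactly one extension of `λ` and `ρ` to the structure monoid. -/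
theorem existsUnique_monoid :
    ∃! p : (S.StructureMonoid → S.StructureMonoid → S.StructureMonoid) ×
      (S.StructureMonoid → S.StructureMonoid → S.StructureMonoid),
      S.IsExtension S.toMonoid p.1 p.2 :=
  S.isEnvelope_toMonoid.existsUnique_extension

/-- The solution `(M, r_M)` on the structure monoid, `r_M (a, b) = (λ_a(b), ρ_b(a))` for the unique
extensions `λ`, `ρ` to `M`. -/
noncomputable def monoidSolution : Solution S.StructureMonoid :=
  S.existsUnique_monoid.choose_spec.1.solution S.isEnvelope_toMonoid

theorem isExtension_monoid :
    S.IsExtension S.toMonoid S.monoidSolution.lam S.monoidSolution.rho :=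
  S.existsUnique_monoid.choose_spec.1

/-! ### The structure group -/

/-- The structure group `G(X, r) = gr(X ∣ x ∘ y = λ_x(y) ∘ ρ_y(x))`. -/
abbrev StructureGroup : Type u :=
  PresentedGroup {w : FreeGroup X | ∃ x y,
    w = (FreeGroup.of x * FreeGroup.of y) *
      (FreeGroup.of (S.lam x y) * FreeGroup.of (S.rho y x))⁻¹}

/-- The canonical map `X → G(X, r)`. -/
def toGroup (x : X) : S.StructureGroup := PresentedGroup.of x

theorem isEnvelope_toGroup : S.IsEnvelope S.toGroup where
  rel x y := PresentedGroup.mk_eq_mk_of_mul_inv_mem ⟨x, y, rfl⟩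
  ind := by
    intro P h1 hx hu h
    have key : ∀ h : S.StructureGroup, ∀ k, P k → P (h * k) := by
      intro h
      obtain ⟨w, rfl⟩ : ∃ w, PresentedGroup.mk _ w = h := PresentedGroup.mk_surjective _ h
      induction w using FreeGroup.induction_on with
      | C1 => intro k hk; simpa using hk
      | of x => intro k hk; exact hx x k hk
      | inv_of x _ =>
        intro k hk
        refine hu x _ (fun y => Group.isUnit _) ?_
        have : S.toGroup x * (PresentedGroup.mk _ (FreeGroup.of x)⁻¹ * k) = k := by
          rw [map_inv]
          exact mul_inv_cancel_left _ _
        rwa [this]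
      | mul v w hv hw =>
        intro k hk
        rw [map_mul, mul_assoc]
        exact hv _ (hw _ hk)
    simpa using key h 1 h1
  lift := by
    intro W _ T hT hu
    have hu' := hu fun x => Group.isUnit _
    choose U hU using hu'
    have hrel : ∀ w ∈ {w : FreeGroup X | ∃ x y, w = (FreeGroup.of x * FreeGroup.of y) *
        (FreeGroup.of (S.lam x y) * FreeGroup.of (S.rho y x))⁻¹}, FreeGroup.lift U w = 1 := by
      rintro w ⟨x, y, rfl⟩
      rw [map_mul, map_inv, mul_inv_eq_one, map_mul, map_mul]
      simp only [FreeGroup.lift_apply_of]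
      apply Units.ext
      simpa [hU] using hT x y
    refine ⟨(Units.coeHom W).comp (PresentedGroup.toGroup hrel), fun x => ?_⟩
    rw [← hU]
    exact congrArg Units.val (PresentedGroup.toGroup.of hrel)

/-- There is exactly one extension of `λ` and `ρ` to the structure group. -/
theorem existsUnique_group :
    ∃! p : (S.StructureGroup → S.StructureGroup → S.StructureGroup) ×
      (S.StructureGroup → S.StructureGroup → S.StructureGroup),
      S.IsExtension S.toGroup p.1 p.2 :=
  S.isEnvelope_toGroup.existsUnique_extension

/-- The solution `(G, r_G)` on the structure group, `r_G (a, b) = (λ_a(b), ρ_b(a))` for the unique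
extensions `λ`, `ρ` to `G`. -/
noncomputable def groupSolution : Solution S.StructureGroup :=
  S.existsUnique_group.choose_spec.1.solution S.isEnvelope_toGroup

theorem isExtension_group :
    S.IsExtension S.toGroup S.groupSolution.lam S.groupSolution.rho :=
  S.existsUnique_group.choose_spec.1

end Solution

end YangBaxter

/-! Write `∼ₙ` for the kernel of the canonical map from a solution to its `n`-th retract. Since that
map is a surjective homomorphism, `∼ₙ` has an intrinsic recursion (`IterRel`,
`toIterRetract_eq_iff`): `x ∼ₙ₊₁ y` when the left and right actions of `x` and `y` on every `z`
agree up to `∼ₙ`. Finite level means that some `∼ₙ` is total, so it suffices to compare these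
relations on `X` and on `H`, where `H` is `M` or `G`.

From `H` down to `X`: `ι` need not be injective. However, `x ↦ λ_x` satisfies the defining relations
of `H`, and so does `x ↦ ρ_x` in the mirror image, so `ι x = ι y` forces `x ∼₁ y`. By induction `ι x
∼ₙ ι y` forces `x ∼ₙ₊₁ y` (`IsEnvelope.iterRel_succ`).

From `X` up to `H`: the map from `X` to its `n`-th retract induces a homomorphism `f` from `H` to
the envelope of that retract, and the kernel of `f` lies in `∼ₙ`. The inductive step rests on two
facts. The map `f` respects the associated solutions (`IsExtension.map`), and the actions of an
envelope on itself depend only on images in the envelope of the retract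
(`IsExtension.lam_eq_of_map_eq`). If two elements agree after one more retraction, they act alike on
the envelope at stage `n`, hence their actions on `H` agree up to the kernel of `f`, hence up to
`∼ₙ`.

At level `m` the retract is a point, and an envelope of a point acts trivially on itself. One
further step therefore makes `∼ₘ₊₁` total on `H`, which is the bound `m + 1`.

`IsEnvelope` treats `M` and `G` together. In inductions over `H`, its third clause (removing a
generator) matters only when the generators are units, and is handled by cancelling. -/

namespace YangBaxter

namespace Solution

variable {X : Type u} (S : Solution X)

/-! ### The kernels of the iterated retractions -/

/-- A homomorphism of solutions. -/
structure IsHom {Y : Type u} (S' : Solution Y) (f : X → Y) : Prop where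
  lam : ∀ x y, f (S.lam x y) = S'.lam (f x) (f y)
  rho : ∀ x y, f (S.rho x y) = S'.rho (f x) (f y)

/-- The relation `x ∼ₙ y` on `X`, which holds if `x` and `y` have the same image in
`Retⁿ(X, r)`. -/
def IterRel : ℕ → X → X → Prop
  | 0, x, y => x = y
  | n + 1, x, y => ∀ z, IterRel n (S.lam x z) (S.lam y z) ∧ IterRel n (S.rho x z) (S.rho y z)

/-- The canonical map from `X` to the underlying set of `Retⁿ(X, r)`. -/
def toIterRetract : ∀ n, X → (S.iterRetract n).1
  | 0 => id
  | n + 1 => fun x => Quotient.mk _ (toIterRetract n x)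

theorem isHom_mk_retract : S.IsHom S.retract (Quotient.mk _) := ⟨fun _ _ => rfl, fun _ _ => rfl⟩

theorem isHom_toIterRetract (n : ℕ) : S.IsHom (S.iterRetract n).2 (S.toIterRetract n) := by
  induction n with
  | zero => exact ⟨fun _ _ => rfl, fun _ _ => rfl⟩
  | succ n ih =>
    exact ⟨fun x y => congrArg (Quotient.mk _) (ih.lam x y),
      fun x y => congrArg (Quotient.mk _) (ih.rho x y)⟩

theorem toIterRetract_surjective (n : ℕ) : Surjective (S.toIterRetract n) := by
  induction n with
  | zero => exact surjective_id
  | succ n ih => exact Quotient.mk_surjective.comp ih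

theorem toIterRetract_eq_iff (n : ℕ) (x y : X) :
    S.toIterRetract n x = S.toIterRetract n y ↔ S.IterRel n x y := by
  induction n generalizing x y with
  | zero => exact Iff.rfl
  | succ n ih =>
    have hom := S.isHom_toIterRetract n
    have hs := S.toIterRetract_surjective n
    refine (Quotient.eq (r := (S.iterRetract n).2.retractSetoid)).trans ?_
    refine (rel_iff _ _ _).trans ?_
    -- By surjectivity, the maps on the retract need testing only on images of elements of `X`,
    -- where the homomorphism property moves the equations back to `X`.
    rw [funext_iff, funext_iff, hs.forall, hs.forall, ← forall_and]
    refine forall_congr' fun z => ?_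
    rw [← hom.lam, ← hom.lam, ← hom.rho, ← hom.rho, ih, ih]

theorem subsingleton_iterRetract_iff (n : ℕ) :
    Subsingleton (S.iterRetract n).1 ↔ ∀ x y, S.IterRel n x y := by
  have hs := S.toIterRetract_surjective n
  rw [subsingleton_iff, hs.forall₂]
  simp only [toIterRetract_eq_iff]

/-! ### Levels in terms of total relations -/

theorem HasLevel.iterRel {S : Solution X} {n : ℕ} (h : S.HasLevel n) (x y : X) :
    S.IterRel n x y :=
  (S.subsingleton_iterRetract_iff n).1 (Cardinal.eq_one_iff_unique.1 h.1).1 x y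

/-- The level is the least index at which the iterated retract is a point; minimality supplies the
condition that the preceding retract is nontrivial. -/
theorem exists_hasLevel_le {S : Solution X} {n : ℕ} (h : ∀ x y, S.IterRel n x y) :
    ∃ k ≤ n, S.HasLevel k := by
  classical
  have hex : ∃ k, Subsingleton (S.iterRetract k).1 := ⟨n, (S.subsingleton_iterRetract_iff n).2 h⟩
  refine ⟨Nat.find hex, Nat.find_min' hex ((S.subsingleton_iterRetract_iff n).2 h),
    Cardinal.eq_one_iff_unique.2 ⟨Nat.find_spec hex, (S.iterRetract _).2.nonempty⟩, fun hpos => ?_⟩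
  have := Nat.find_min hex (Nat.sub_lt hpos one_pos)
  exact Cardinal.one_lt_iff_nontrivial.2 (not_subsingleton_iff_nontrivial.1 this)

/-! ### Extensions and the relations `∼ₙ` -/

section Envelope

variable {S} {H : Type u} [Monoid H] {ι : X → H} {L R : H → H → H}

/-! ### Fibres of the canonical map -/

theorem isUnit_functionEnd {Y : Type u} {f : Function.End Y} (hf : Bijective f) : IsUnit f := by
  obtain ⟨g, hl, hr⟩ := bijective_iff_has_inverse.1 hf
  exact ⟨⟨f, g, funext hr, funext hl⟩, rfl⟩

/-- The first braid identity says that `x ↦ λ_x` respects the defining relations, and each `λ_x` is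
invertible, so it extends to an action of `H` on `X`. Thus `λ_x` depends only on `ι x`. -/
theorem IsEnvelope.lam_eq_of_eq (E : S.IsEnvelope ι) {x y : X} (e : ι x = ι y) :
    S.lam x = S.lam y := by
  obtain ⟨f, hf⟩ := E.lift (Function.End X) S.lam
    (fun x y => funext fun z => (S.lam_lam x y z).symm)
    (fun _ x => isUnit_functionEnd (S.lam_bij x))
  rw [← hf x, ← hf y, e]

theorem IsEnvelope.rel_of_eq (E : S.IsEnvelope ι) {x y : X} (e : ι x = ι y) :
    S.retractSetoid x y :=
  ⟨E.lam_eq_of_eq e, E.mirror.lam_eq_of_eq (congrArg MulOpposite.op e)⟩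

/-- The map `ι` need not be injective, but its fibres lie in classes of `∼₁`. -/
theorem IsEnvelope.iterRel_succ (E : S.IsEnvelope ι) {T : Solution H}
    (h : S.IsExtension ι T.lam T.rho) {n : ℕ} {x y : X} (hxy : T.IterRel n (ι x) (ι y)) :
    S.IterRel (n + 1) x y := by
  induction n generalizing x y with
  | zero =>
    -- The shift from `n` to `n + 1` originates here: equality in `H` yields only `∼₁` in `X`.
    have := E.rel_of_eq hxy
    exact fun z => ⟨congrFun this.1 z, congrFun this.2 z⟩
  | succ n ih =>
    intro z
    -- Testing against generators is enough, since there the actions of `H` restrict to those of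
    -- `X`.
    obtain ⟨h1, h2⟩ := hxy (ι z)
    rw [h.lam_gen, h.lam_gen] at h1
    rw [h.rho_gen, h.rho_gen] at h2
    exact ⟨ih h1, ih h2⟩

/-! ### Functoriality of the associated solution -/

variable {Y : Type u} {S' : Solution Y} {H' : Type u} [Monoid H'] {ι' : Y → H'}
  {L' R' : H' → H' → H'} {π : X → Y} {f : H →* H'}

/-- Homomorphisms of solutions extend to homomorphisms of the associated solutions. -/
theorem IsExtension.map (E : S.IsEnvelope ι) (h : S.IsExtension ι L R)
    (h' : S'.IsExtension ι' L' R') (hπ : S.IsHom S' π) (hf : ∀ x, f (ι x) = ι' (π x)) (a c : H) :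
    f (L a c) = L' (f a) (f c) ∧ f (R c a) = R' (f c) (f a) := by
  have key : ∀ m x, f (L (ι x) m) = L' (ι' (π x)) (f m) ∧
      f (R m (ι x)) = R' (f m) (ι' (π x)) := by
    apply E.ind
    · intro x
      rw [h.lam_unit, h.rho_one, map_one, h'.lam_unit, h'.rho_one, hf]
      exact ⟨rfl, rfl⟩
    · intro y m ih x
      rw [h.lam_prod, h.rho_mul, map_mul, map_mul, h'.lam_prod, h'.rho_mul, h.lam_gen, h.rho_gen,
        hf, hf, h'.lam_gen, h'.rho_gen, hπ.lam, (ih _).1, (ih _).2, hπ.rho]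
      exact ⟨rfl, rfl⟩
    · intro y m hu ih x'
      -- Passing `x` across the letter `y` turns it into `ρ_y(x)`. To reach an arbitrary element in
      -- the removal step, it is written in this form first.
      obtain ⟨x, rfl⟩ := (S.rho_bij y).2 x'
      have := ih x
      rw [h.lam_prod, h.rho_mul, map_mul, map_mul, h'.lam_prod, h'.rho_mul, h.lam_gen, h.rho_gen,
        hf, hf, h'.lam_gen, h'.rho_gen, hπ.lam, ← hπ.rho] at this
      refine ⟨IsUnit.mul_left_cancel ?_ this.1, this.2⟩
      rw [← hπ.lam, ← hf]
      exact (hu _).map f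
  revert a c
  apply E.ind
  · intro c
    rw [h.lam_one, h.rho_unit, map_one, h'.lam_one, h'.rho_unit]
    exact ⟨rfl, rfl⟩
  · intro x a ih c
    rw [h.lam_mul, h.rho_prod, map_mul, map_mul, h'.lam_mul, h'.rho_prod, (key _ x).1,
      (key _ x).2, (ih c).1, (ih c).2, hf]
    exact ⟨rfl, rfl⟩
  · intro x a hu ih c
    have := ih c
    rw [h.lam_mul, h.rho_prod, map_mul, map_mul, h'.lam_mul, h'.rho_prod, hf, (key _ x).1,
      (key _ x).2] at this
    have hu' : IsUnit (ι' (π x)) := by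
      rw [← hf]
      exact (hu x).map f
    have h1 := h'.lam_inj hu' this.1
    rw [h1] at this
    -- The factor to be cancelled is the image under `f` of an element of `H`. When the generators
    -- are units, so is every element of `H`.
    refine ⟨h1, IsUnit.mul_left_cancel ?_ this.2⟩
    have := (E.isUnit hu (R (L a c) (ι x))).map f
    rwa [(key _ x).2, h1] at this

/-! ### Actions factor through envelopes of quotients -/

/-- Equivalent elements act equally on a letter `z`, and continue on the rest of the word as
`ρ_z(x)` and `ρ_z(y)`, which are again equivalent. Removing a letter needs the converse, that `ρ_z`
reflects `∼`. -/
theorem IsExtension.lam_gen_eq (E : S.IsEnvelope ι) (h : S.IsExtension ι L R) (c : H) :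
    ∀ x y, S.retractSetoid x y → L (ι x) c = L (ι y) c := by
  revert c
  apply E.ind
  · intro x y _
    rw [h.lam_unit, h.lam_unit]
  · intro z c ih x y hxy
    rw [h.lam_prod, h.lam_prod, h.lam_gen, h.lam_gen, h.rho_gen, h.rho_gen, hxy.1,
      ih _ _ (S.rho_congr (S.retractSetoid.refl z) hxy)]
  · intro z c hu ih x' y' hxy
    obtain ⟨x, rfl⟩ := (S.rho_bij z).2 x'
    obtain ⟨y, rfl⟩ := (S.rho_bij z).2 y'
    have hxy' := S.rho_reflects z hxy
    have := ih x y hxy'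
    rw [h.lam_prod, h.lam_prod, h.lam_gen, h.lam_gen, h.rho_gen, h.rho_gen, hxy'.1] at this
    exact (hu _).mul_left_cancel this

/-- The action `λ` factors through the envelope of any quotient of `X` by a relation contained
in `∼`. -/
theorem IsExtension.lam_eq_of_map_eq (E : S.IsEnvelope ι) (h : S.IsExtension ι L R)
    (E' : S'.IsEnvelope ι') (hπ : S.IsHom S' π) (hs : Surjective π)
    (hker : ∀ x y, π x = π y → S.retractSetoid x y) (hf : ∀ x, f (ι x) = ι' (π x)) {a b : H}
    (hab : f a = f b) : L a = L b := by
  -- The section `σ` need not be a homomorphism: `L ∘ ι` is constant on the fibres of `π`, so `u ↦ L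
  -- (ι (σ u))` still satisfies the relations over `Y`. Its extension `g` then satisfies `g ∘ f =
  -- L`.
  obtain ⟨σ, hσ⟩ := hs.hasRightInverse
  have hL : ∀ x, L (ι (σ (π x))) = L (ι x) := fun x =>
    funext fun c => h.lam_gen_eq E c _ _ (hker _ _ (hσ _))
  obtain ⟨g, hg⟩ := E'.lift (Function.End H) (fun u => L (ι (σ u))) (by
      rw [hs.forall₂]
      intro x y
      rw [← hπ.lam, ← hπ.rho, hL, hL, hL, hL]
      funext c
      change L (ι x) (L (ι y) c) = L (ι (S.lam x y)) (L (ι (S.rho y x)) c)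
      rw [← h.lam_mul, ← h.lam_mul, E.rel])
    (fun _ u => isUnit_functionEnd (h.lam_bijective E _))
  have key : ∀ a, g (f a) = L a := by
    apply E.ind
    · rw [map_one, map_one]
      exact funext fun c => (h.lam_one c).symm
    · intro x a ih
      rw [map_mul, map_mul, ih, hf, hg, hL]
      exact funext fun c => (h.lam_mul _ _ c).symm
    · intro x a hu ih
      rw [map_mul, map_mul, hf, hg, hL] at ih
      refine funext fun c => h.lam_inj (hu x) ?_
      rw [← h.lam_mul]
      exact congrFun ih c
  rw [← key a, ← key b, hab]

/-- The mirror image, with the opposite monoid as envelope, exchanges `L` and `R`, so the statement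
for `R` is the one for `L` applied there. -/
theorem IsExtension.lam_rho_eq_of_map_eq (E : S.IsEnvelope ι) (h : S.IsExtension ι L R)
    (E' : S'.IsEnvelope ι') (hπ : S.IsHom S' π) (hs : Surjective π)
    (hker : ∀ x y, π x = π y → S.retractSetoid x y) (hf : ∀ x, f (ι x) = ι' (π x)) {a b : H}
    (hab : f a = f b) : L a = L b ∧ R a = R b := by
  refine ⟨h.lam_eq_of_map_eq E E' hπ hs hker hf hab, ?_⟩
  have hπ' : S.mirror.IsHom S'.mirror π := ⟨hπ.rho, hπ.lam⟩
  have := h.mirror.lam_eq_of_map_eq E.mirror E'.mirror hπ' hs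
    (fun x y e => ⟨(hker x y e).2, (hker x y e).1⟩) (f := f.op)
    (fun x => congrArg MulOpposite.op (hf x)) (a := MulOpposite.op a) (b := MulOpposite.op b)
    (congrArg MulOpposite.op hab)
  exact funext fun c => congrArg MulOpposite.unop (congrFun this (MulOpposite.op c))

/-- Over a point every generator fixes every letter and passes through it unchanged, hence fixes all
words. This triviality ends the chain of retractions. -/
theorem IsExtension.lam_eq_self [Subsingleton X] (E : S.IsEnvelope ι) (h : S.IsExtension ι L R)
    (a c : H) : L a c = c := by
  have key : ∀ c x, L (ι x) c = c := by
    apply E.ind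
    · intro x
      rw [h.lam_unit]
    · intro z c ih x
      rw [h.lam_prod, h.lam_gen, h.rho_gen, ih, Subsingleton.elim (S.lam x z) z]
    · intro z c hu ih x
      have := ih x
      rw [h.lam_prod, h.lam_gen, h.rho_gen, Subsingleton.elim (S.lam x z) z,
        Subsingleton.elim (S.rho z x) x] at this
      exact (hu _).mul_left_cancel this
  revert a
  apply E.ind
  · exact h.lam_one c
  · intro x a ih
    rw [h.lam_mul, ih, key]
  · intro x a _ ih
    rwa [h.lam_mul, key] at ih

theorem IsExtension.rho_eq_self [Subsingleton X] (E : S.IsEnvelope ι) (h : S.IsExtension ι L R)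
    (a c : H) : R a c = c :=
  congrArg MulOpposite.unop
    (h.mirror.lam_eq_self E.mirror (MulOpposite.op a) (MulOpposite.op c))

/-- If the fibres of the map induced by `X → Y` lie in classes of `∼ₙ`, then those of the map
induced by `X → Y → Ret(Y)` lie in classes of `∼ₙ₊₁`. -/
theorem IsExtension.iterRel_succ_of_retract {T : Solution H} (E : S.IsEnvelope ι)
    (h : S.IsExtension ι T.lam T.rho) (E' : S'.IsEnvelope ι') (h' : S'.IsExtension ι' L' R')
    (hπ : S.IsHom S' π) (hf : ∀ x, f (ι x) = ι' (π x)) {n : ℕ}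
    (hn : ∀ a b, f a = f b → T.IterRel n a b) {H'' : Type u} [Monoid H'']
    {ι'' : Quotient S'.retractSetoid → H''} (E'' : S'.retract.IsEnvelope ι'') {g : H' →* H''}
    (hg : ∀ y, g (ι' y) = ι'' (Quotient.mk _ y)) {a b : H} (hab : g (f a) = g (f b)) :
    T.IterRel (n + 1) a b := by
  obtain ⟨e1, e2⟩ := h'.lam_rho_eq_of_map_eq E' E'' S'.isHom_mk_retract Quotient.mk_surjective
    (fun _ _ e => Quotient.exact e) hg hab
  intro c
  constructor
  · apply hn
    -- `f a` and `f b` may differ, but they act in the same way on `H'`; so the results of acting by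
    -- `a` and `b` on `c` have equal images under `f`.
    rw [(h.map E h' hπ hf a c).1, (h.map E h' hπ hf b c).1, e1]
  · apply hn
    rw [(h.map E h' hπ hf c a).2, (h.map E h' hπ hf c b).2, e2]

/-- The envelope of a point is usually not a point, so `f` need not identify `a` and `b`. Its
actions are trivial, however, so acting by `a` or by `b` on `c` gives results with the same image `f
c`. This costs the one extra retraction. -/
theorem IsExtension.iterRel_succ_of_subsingleton [Subsingleton Y] {T : Solution H}
    (E : S.IsEnvelope ι) (h : S.IsExtension ι T.lam T.rho) (E' : S'.IsEnvelope ι')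
    (h' : S'.IsExtension ι' L' R') (hπ : S.IsHom S' π) (hf : ∀ x, f (ι x) = ι' (π x)) {n : ℕ}
    (hn : ∀ a b, f a = f b → T.IterRel n a b) (a b : H) : T.IterRel (n + 1) a b := by
  intro c
  constructor
  · apply hn
    rw [(h.map E h' hπ hf a c).1, (h.map E h' hπ hf b c).1, h'.lam_eq_self E', h'.lam_eq_self E']
  · apply hn
    rw [(h.map E h' hπ hf c a).2, (h.map E h' hπ hf c b).2, h'.rho_eq_self E', h'.rho_eq_self E']

end Envelope

/-! ### Structure monoids and structure groups of iterated retracts -/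

theorem exists_monoidHom_retract :
    ∃ f : S.StructureMonoid →* S.retract.StructureMonoid,
      ∀ x, f (S.toMonoid x) = S.retract.toMonoid (Quotient.mk _ x) := by
  refine ⟨PresentedMonoid.lift (fun x => S.retract.toMonoid (Quotient.mk _ x)) ?_, fun x => rfl⟩
  rintro a b ⟨x, y, rfl, rfl⟩
  simp only [map_mul, FreeMonoid.lift_eval_of]
  exact S.retract.isEnvelope_toMonoid.rel (Quotient.mk _ x) (Quotient.mk _ y)

theorem exists_groupHom_retract :
    ∃ f : S.StructureGroup →* S.retract.StructureGroup,
      ∀ x, f (S.toGroup x) = S.retract.toGroup (Quotient.mk _ x) :=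
  S.isEnvelope_toGroup.lift _ (fun x => S.retract.toGroup (Quotient.mk _ x))
    (fun x y => S.retract.isEnvelope_toGroup.rel (Quotient.mk _ x) (Quotient.mk _ y))
    (fun _ _ => Group.isUnit _)

/-- The homomorphism is built one retraction at a time, because the kernel bound at stage `n + 1`
uses both the bound at stage `n` and the envelope of the `n`-th retract. -/
theorem exists_monoidHom_iterRetract (n : ℕ) :
    ∃ f : S.StructureMonoid →* (S.iterRetract n).2.StructureMonoid,
      (∀ x, f (S.toMonoid x) = (S.iterRetract n).2.toMonoid (S.toIterRetract n x)) ∧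
      ∀ a b, f a = f b → S.monoidSolution.IterRel n a b := by
  induction n with
  | zero => exact ⟨MonoidHom.id _, fun _ => rfl, fun _ _ e => e⟩
  | succ n ih =>
    obtain ⟨f, hf, hn⟩ := ih
    obtain ⟨g, hg⟩ := (S.iterRetract n).2.exists_monoidHom_retract
    refine ⟨g.comp f, fun x => (congrArg g (hf x)).trans (hg _), fun a b e => ?_⟩
    exact S.isExtension_monoid.iterRel_succ_of_retract S.isEnvelope_toMonoid
      (isEnvelope_toMonoid _) (isExtension_monoid _) (S.isHom_toIterRetract n) hf hn
      (isEnvelope_toMonoid _) hg e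

theorem exists_groupHom_iterRetract (n : ℕ) :
    ∃ f : S.StructureGroup →* (S.iterRetract n).2.StructureGroup,
      (∀ x, f (S.toGroup x) = (S.iterRetract n).2.toGroup (S.toIterRetract n x)) ∧
      ∀ a b, f a = f b → S.groupSolution.IterRel n a b := by
  induction n with
  | zero => exact ⟨MonoidHom.id _, fun _ => rfl, fun _ _ e => e⟩
  | succ n ih =>
    obtain ⟨f, hf, hn⟩ := ih
    obtain ⟨g, hg⟩ := (S.iterRetract n).2.exists_groupHom_retract
    refine ⟨g.comp f, fun x => (congrArg g (hf x)).trans (hg _), fun a b e => ?_⟩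
    exact S.isExtension_group.iterRel_succ_of_retract S.isEnvelope_toGroup
      (isEnvelope_toGroup _) (isExtension_group _) (S.isHom_toIterRetract n) hf hn
      (isEnvelope_toGroup _) hg e

/-! ### Transfer of levels between a solution and its associated solutions -/

variable {S}

theorem HasLevel.monoidSolution {m : ℕ} (h : S.HasLevel m) :
    ∃ k ≤ m + 1, S.monoidSolution.HasLevel k := by
  obtain ⟨f, hf, hn⟩ := S.exists_monoidHom_iterRetract m
  have := (S.subsingleton_iterRetract_iff m).2 h.iterRel
  exact exists_hasLevel_le (S.isExtension_monoid.iterRel_succ_of_subsingleton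
    S.isEnvelope_toMonoid (isEnvelope_toMonoid _) (isExtension_monoid _)
    (S.isHom_toIterRetract m) hf hn)

theorem HasLevel.groupSolution {m : ℕ} (h : S.HasLevel m) :
    ∃ k ≤ m + 1, S.groupSolution.HasLevel k := by
  obtain ⟨f, hf, hn⟩ := S.exists_groupHom_iterRetract m
  have := (S.subsingleton_iterRetract_iff m).2 h.iterRel
  exact exists_hasLevel_le (S.isExtension_group.iterRel_succ_of_subsingleton
    S.isEnvelope_toGroup (isEnvelope_toGroup _) (isExtension_group _)
    (S.isHom_toIterRetract m) hf hn)

/-- If `∼ₙ` is total on `H`, it relates all elements `ι x` and `ι y`, so `∼ₙ₊₁` is total on `X`. -/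
theorem FiniteLevel.of_extension {H : Type u} [Monoid H] {ι : X → H} {T : Solution H}
    (hT : T.FiniteLevel) (E : S.IsEnvelope ι) (h : S.IsExtension ι T.lam T.rho) :
    S.FiniteLevel := by
  obtain ⟨n, hn⟩ := hT
  obtain ⟨k, -, hk⟩ := exists_hasLevel_le fun x y => E.iterRel_succ h (hn.iterRel (ι x) (ι y))
  exact ⟨k, hk⟩

end Solution

end YangBaxter

theorem mainTheorem2 {X : Type u} (S : YangBaxter.Solution X) :
    List.TFAE [S.FiniteLevel, S.monoidSolution.FiniteLevel, S.groupSolution.FiniteLevel] ∧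
    ∀ m : ℕ, S.HasLevel m →
      (∃ k ≤ m + 1, S.monoidSolution.HasLevel k) ∧ (∃ k ≤ m + 1, S.groupSolution.HasLevel k) := by
  refine ⟨?_, fun m h => ⟨h.monoidSolution, h.groupSolution⟩⟩
  tfae_have 1 → 2 := fun ⟨_, h⟩ => h.monoidSolution.imp fun _ hk => hk.2
  tfae_have 1 → 3 := fun ⟨_, h⟩ => h.groupSolution.imp fun _ hk => hk.2
  tfae_have 2 → 1 := fun h => h.of_extension S.isEnvelope_toMonoid S.isExtension_monoid
  tfae_have 3 → 1 := fun h => h.of_extension S.isEnvelope_toGroup S.isExtension_group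
  tfae_finish
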